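/- Let $n,s$ be natural numbers with $s\ge 2$ and $n-s\ge 2$. Let $M$ be a Kähler manifold of indefinite metric of real dimension $2n$: a smooth manifold with a smooth metric $g$ of signature $(2s,2(n-s))$ ($2s$ minus signs) and a smooth almost complex structure $J$ such that $J^2=-\mathrm{id}$, $g(JX,JY)=g(X,Y)$ and $\nabla J=0$, where $\nabla$ is the Levi-Civita connection of $g$. Let $R(X,Y)=[\nabla_X,\nabla_Y]-\nabla_{[X,Y]}$ and $R(x,y,z,u)=g(R(x,y)z,u)$ be its curvature. For a curvature-like tensor $T$ on a tangent space with orthonormal basis $e_1,\dots,e_{2n}$ put $$\rho(T)(y,z)=\sum_i g(e_i,e_i)T(e_i,y,z,e_i),\qquad \rho^*(T)(y,z)=\sum_i g(e_i,e_i)T(e_i,y,Jz,Je_i),$$ $$\tau(T)=\sum_i g(e_i,e_i)\rho(T)(e_i,e_i),\qquad \tau^*(T)=\sum_i g(e_i,e_i)\rho^*(T)(e_i,e_i),\qquad \overline T(x,y,z,u)=T(Jx,Jy,Jz,Ju),$$ and for a bilinear form $S$ put $$\varphi(S)(x,y,z,u)=g(y,z)S(x,u)-g(x,z)S(y,u)+g(x,u)S(y,z)-g(y,u)S(x,z),$$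 $$\psi(S)(x,y,z,u)=g(y,Jz)S(x,Ju)-g(x,Jz)S(y,Ju)-2g(x,Jy)S(z,Ju)+g(x,Ju)S(y,Jz)-g(y,Ju)S(x,Jz)-2g(z,Ju)S(x,Jy),$$ $\pi_1=\tfrac12\varphi(g)$ and $\pi_2=\tfrac12\psi(g)$. The Bochner curvature tensor is $$B(R)=R-\frac{(\varphi+\psi)\big((\rho+3\rho^*)(R+\overline R)\big)}{16(n+2)}-\frac{(3\varphi-\psi)\big((\rho-\rho^*)(R+\overline R)\big)}{16(n-2)}-\frac{\psi(\rho^*(R-\overline R))}{4(n+1)}-\frac{\varphi(\rho(R-\overline R))}{4(n-1)}$$ $$+\frac{(\tau+3\tau^*)(R)}{16(n+1)(n+2)}(\pi_1+\pi_2)+\frac{(\tau-\tau^*)(R)}{16(n-1)(n-2)}(3\pi_1-\pi_2).$$ Then the following conditions are equivalent: 1) $R(\xi,J\xi,J\xi,\xi)=0$ for every point $p\in M$ and every isotropic vector $\xi\in T_pM$ (that is, $g(\xi,\xi)=0$); 2) $B(R)=0$ on $M$. -/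

import Mathlib

open scoped Manifold ContDiff

noncomputable section

/-! ## Algebra of four-tensors on a vector space with an inner product `g` and a structure `J` -/

namespace Hermitian

variable {V ι : Type*} [Fintype ι]

/-- Ricci contraction `∑ᵢ g(eᵢ, eᵢ) T(eᵢ, y, z, eᵢ)` along a `g`-orthonormal basis `e`. -/
def ricci (g : V → V → ℝ) (e : ι → V) (T : V → V → V → V → ℝ) (y z : V) : ℝ :=
  ∑ i, g (e i) (e i) * T (e i) y z (e i)

/-- Ricci `*`-contraction `∑ᵢ g(eᵢ, eᵢ) T(eᵢ, y, Jz, Jeᵢ)` along a `g`-orthonormal basis `e`. -/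
def ricciStar (g : V → V → ℝ) (J : V → V) (e : ι → V) (T : V → V → V → V → ℝ) (y z : V) : ℝ :=
  ∑ i, g (e i) (e i) * T (e i) y (J z) (J (e i))

/-- The `g`-trace of a `(0,2)`-tensor along a `g`-orthonormal basis `e`. -/
def trace (g : V → V → ℝ) (e : ι → V) (S : V → V → ℝ) : ℝ :=
  ∑ i, g (e i) (e i) * S (e i) (e i)

/-- The tensor `φ(S)`. -/
def phi (g : V → V → ℝ) (S : V → V → ℝ) (x y z u : V) : ℝ :=
  g y z * S x u - g x z * S y u + g x u * S y z - g y u * S x z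

/-- The tensor `ψ(S)`. -/
def psi (g : V → V → ℝ) (J : V → V) (S : V → V → ℝ) (x y z u : V) : ℝ :=
  g y (J z) * S x (J u) - g x (J z) * S y (J u) - 2 * g x (J y) * S z (J u)
    + g x (J u) * S y (J z) - g y (J u) * S x (J z) - 2 * g z (J u) * S x (J y)

/-- The tensor `π₁`. -/
def pi₁ (g : V → V → ℝ) (x y z u : V) : ℝ :=
  g y z * g x u - g x z * g y u

/-- The tensor `π₂`. -/
def pi₂ (g : V → V → ℝ) (J : V → V) (x y z u : V) : ℝ :=
  g y (J z) * g x (J u) - g x (J z) * g y (J u) - 2 * g x (J y) * g z (J u)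

/-- The tensor `T̄(x, y, z, u) = T(Jx, Jy, Jz, Ju)`. -/
def conj (J : V → V) (T : V → V → V → V → ℝ) (x y z u : V) : ℝ :=
  T (J x) (J y) (J z) (J u)

/-- The Bochner tensor `B(T)` of a curvature-like tensor `T` on a Hermitian space of real
dimension `2n ≥ 6` (with inner product `g`, complex structure `J` and an orthonormal basis `e`). -/
def bochner (n : ℕ) (g : V → V → ℝ) (J : V → V) (e : ι → V) (T : V → V → V → V → ℝ)
    (x y z u : V) : ℝ :=
  let ρ := ricci g e
  let ρs := ricciStar g J e
  let τ := trace g e (ρ T)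
  let τs := trace g e (ρs T)
  let P := T + conj J T
  let Q := T - conj J T
  T x y z u
    - 1 / (16 * ((n : ℝ) + 2)) *
        (phi g (ρ P + 3 • ρs P) x y z u + psi g J (ρ P + 3 • ρs P) x y z u)
    - 1 / (16 * ((n : ℝ) - 2)) *
        (3 * phi g (ρ P - ρs P) x y z u - psi g J (ρ P - ρs P) x y z u)
    - 1 / (4 * ((n : ℝ) + 1)) * psi g J (ρs Q) x y z u
    - 1 / (4 * ((n : ℝ) - 1)) * phi g (ρ Q) x y z u
    + (τ + 3 * τs) / (16 * ((n : ℝ) + 1) * ((n : ℝ) + 2)) * (pi₁ g x y z u + pi₂ g J x y z u)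
    + (τ - τs) / (16 * ((n : ℝ) - 1) * ((n : ℝ) - 2)) * (3 * pi₁ g x y z u - pi₂ g J x y z u)

end Hermitian

/-! ## Metrics, almost complex structures, connections and curvature on a manifold -/

section Geometry

/-- A smooth metric on the `m`-dimensional manifold `M` of signature `(ν, m - ν)`: every tangent
space has an orthonormal basis whose first `ν` vectors are of square `-1` and whose other vectors
are of square `1`. -/
structure IndefiniteMetric (m ν : ℕ) (M : Type*) [TopologicalSpace M]
    [ChartedSpace (EuclideanSpace ℝ (Fin m)) M] [IsManifold (𝓡 m) ∞ M] where
  /-- the inner product on each tangent space -/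
  inner (p : M) : TangentSpace (𝓡 m) p →L[ℝ] TangentSpace (𝓡 m) p →L[ℝ] ℝ
  symm (p : M) (x y : TangentSpace (𝓡 m) p) : inner p x y = inner p y x
  contMDiff : ContMDiff (𝓡 m)
    ((𝓡 m).prod 𝓘(ℝ, EuclideanSpace ℝ (Fin m) →L[ℝ] EuclideanSpace ℝ (Fin m) →L[ℝ] ℝ)) ∞
    (fun p ↦ Bundle.TotalSpace.mk'
      (EuclideanSpace ℝ (Fin m) →L[ℝ] EuclideanSpace ℝ (Fin m) →L[ℝ] ℝ)
      (E := fun p : M ↦ TangentSpace (𝓡 m) p →L[ℝ] TangentSpace (𝓡 m) p →L[ℝ] ℝ) p (inner p))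
  exists_basis (p : M) : ∃ e : Module.Basis (Fin m) ℝ (TangentSpace (𝓡 m) p),
    ∀ i j, inner p (e i) (e j) = if i = j then (if (i : ℕ) < ν then -1 else 1) else 0

variable {m ν : ℕ} {M : Type*} [TopologicalSpace M]
  [ChartedSpace (EuclideanSpace ℝ (Fin m)) M] [IsManifold (𝓡 m) ∞ M]

/-- An orthonormal basis of the tangent space at `p`. -/
def IndefiniteMetric.basis (g : IndefiniteMetric m ν M) (p : M) :
    Module.Basis (Fin m) ℝ (TangentSpace (𝓡 m) p) :=
  (g.exists_basis p).choose

/-- A smooth almost complex structure `J` on `M` with `g(JX, JY) = g(X, Y)`. -/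
structure HermitianStructure (g : IndefiniteMetric m ν M) where
  /-- the endomorphism of each tangent space -/
  J (p : M) : TangentSpace (𝓡 m) p →L[ℝ] TangentSpace (𝓡 m) p
  contMDiff : ContMDiff (𝓡 m)
    ((𝓡 m).prod 𝓘(ℝ, EuclideanSpace ℝ (Fin m) →L[ℝ] EuclideanSpace ℝ (Fin m))) ∞
    (fun p ↦ Bundle.TotalSpace.mk' (EuclideanSpace ℝ (Fin m) →L[ℝ] EuclideanSpace ℝ (Fin m))
      (E := fun p : M ↦ TangentSpace (𝓡 m) p →L[ℝ] TangentSpace (𝓡 m) p) p (J p))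
  sq (p : M) (x : TangentSpace (𝓡 m) p) : J p (J p x) = -x
  isometry (p : M) (x y : TangentSpace (𝓡 m) p) : g.inner p (J p x) (J p y) = g.inner p x y

/-- The vector field `Y` is differentiable at `p`. -/
def IsDifferentiableField (Y : Π p : M, TangentSpace (𝓡 m) p) (p : M) : Prop :=
  MDifferentiableAt (𝓡 m) (𝓡 m).tangent (fun q ↦ (⟨q, Y q⟩ : TangentBundle (𝓡 m) M)) p

/-- `∇` is the Levi-Civita connection of `g`: the smooth torsion-free connection on the tangent
bundle with `X g(Y, Z) = g(∇_X Y, Z) + g(Y, ∇_X Z)`. Here `∇ Y p x` is `∇_x Y` at `p`. -/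
structure IsLeviCivita (g : IndefiniteMetric m ν M)
    (nabla : CovariantDerivative (𝓡 m) (EuclideanSpace ℝ (Fin m))
      (fun p : M ↦ TangentSpace (𝓡 m) p)) : Prop where
  contMDiff : nabla.ContMDiffCovariantDerivative ∞
  torsion : nabla.torsion = 0
  metric {Y Z : Π p : M, TangentSpace (𝓡 m) p} {p : M}
    (hY : IsDifferentiableField Y p) (hZ : IsDifferentiableField Z p) (x : TangentSpace (𝓡 m) p) :
    mvfderiv (𝓡 m) (fun q ↦ g.inner q (Y q) (Z q)) p x
      = g.inner p (nabla Y p x) (Z p) + g.inner p (Y p) (nabla Z p x)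

/-- The endomorphism field `J` is parallel: `∇_X (J Y) = J (∇_X Y)`. -/
def IsParallel
    (nabla : CovariantDerivative (𝓡 m) (EuclideanSpace ℝ (Fin m))
      (fun p : M ↦ TangentSpace (𝓡 m) p))
    (J : Π p : M, TangentSpace (𝓡 m) p →L[ℝ] TangentSpace (𝓡 m) p) : Prop :=
  ∀ (Y : Π p : M, TangentSpace (𝓡 m) p) (p : M), IsDifferentiableField Y p →
    ∀ x : TangentSpace (𝓡 m) p, nabla (fun q ↦ J q (Y q)) p x = J p (nabla Y p x)

/-- `R(X, Y)Z = ∇_X ∇_Y Z - ∇_Y ∇_X Z - ∇_[X, Y] Z` for vector fields `X`, `Y`, `Z`. -/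
def curvatureField
    (nabla : CovariantDerivative (𝓡 m) (EuclideanSpace ℝ (Fin m))
      (fun p : M ↦ TangentSpace (𝓡 m) p))
    (X Y Z : Π p : M, TangentSpace (𝓡 m) p) (p : M) : TangentSpace (𝓡 m) p :=
  nabla (fun q ↦ nabla Z q (Y q)) p (X p) - nabla (fun q ↦ nabla Z q (X q)) p (Y p)
    - nabla Z p (VectorField.mlieBracket (𝓡 m) X Y p)

/-- The curvature operator `R(x, y)z` on tangent vectors at `p`, computed with Mathlib's
extensions of `x`, `y`, `z` to vector fields that are smooth near `p` (for a smooth connection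
the value does not depend on the extensions). -/
def curvature
    (nabla : CovariantDerivative (𝓡 m) (EuclideanSpace ℝ (Fin m))
      (fun p : M ↦ TangentSpace (𝓡 m) p))
    (p : M) (x y z : TangentSpace (𝓡 m) p) : TangentSpace (𝓡 m) p :=
  curvatureField nabla
    (FiberBundle.extend (EuclideanSpace ℝ (Fin m)) x)
    (FiberBundle.extend (EuclideanSpace ℝ (Fin m)) y)
    (FiberBundle.extend (EuclideanSpace ℝ (Fin m)) z) p

/-- The curvature tensor `R(x, y, z, u) = g(R(x, y)z, u)`. -/
def curvatureTensor (g : IndefiniteMetric m ν M)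
    (nabla : CovariantDerivative (𝓡 m) (EuclideanSpace ℝ (Fin m))
      (fun p : M ↦ TangentSpace (𝓡 m) p))
    (p : M) (x y z u : TangentSpace (𝓡 m) p) : ℝ :=
  g.inner p (curvature nabla p x y z) u

/-- The Bochner curvature tensor at `p` of an almost Hermitian manifold of real dimension `2n`. -/
def bochnerTensor {n : ℕ} {M : Type*} [TopologicalSpace M]
    [ChartedSpace (EuclideanSpace ℝ (Fin (2 * n))) M] [IsManifold (𝓡 (2 * n)) ∞ M]
    (g : IndefiniteMetric (2 * n) ν M) (H : HermitianStructure g)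
    (nabla : CovariantDerivative (𝓡 (2 * n)) (EuclideanSpace ℝ (Fin (2 * n)))
      (fun p : M ↦ TangentSpace (𝓡 (2 * n)) p))
    (p : M) (x y z u : TangentSpace (𝓡 (2 * n)) p) : ℝ :=
  Hermitian.bochner n (fun v w ↦ g.inner p v w) (fun v ↦ H.J p v) (g.basis p)
    (curvatureTensor g nabla p) x y z u

end Geometry

end

/-! Apart from the symmetries of the curvature, the statement is pointwise algebra. The quartic form
R(x,Jx,Jx,x) vanishes on the null cone exactly when it is divisible by g(x,x), say R(x,Jx,Jx,x) =
g(x,x) S₀(x,x); the quotient comes from restricting the form to the null vectors obtained by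
combining a negative and a positive vector (`exists_bilinear_of_quartic_null`). Averaging S₀ gives a
symmetric J-invariant S for which (φ+ψ)(S) is a Kähler tensor with the same holomorphic sectional
curvatures as R. A Kähler tensor is determined by those (`IsKaehlerTensor.eq_zero_of_holomorphic`),
so R = (φ+ψ)(S), and contracting shows that its Bochner tensor vanishes (`bochner_phi_add_psi`).

Conversely, at (ξ,Jξ,Jξ,ξ) with ξ null every correction term of B(R) has a factor g(ξ,ξ), g(ξ,Jξ) or
g(Jξ,Jξ), all zero, so B(R) and R agree there.

The geometric input is that the curvature of a parallel Hermitian structure is a Kähler tensor at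
each point (`IsLeviCivita.isKaehlerTensor`). -/

noncomputable section

namespace Hermitian

variable {V : Type*} [AddCommGroup V] [Module ℝ V]

/-! ### Quartic forms vanishing on the null cone -/

section Quartic

/-- The sum of the values of a quadrilinear form over the placements of one argument `v` among
three arguments `u`. -/
def mixedThreeOne (K : V →ₗ[ℝ] V →ₗ[ℝ] V →ₗ[ℝ] V →ₗ[ℝ] ℝ) (u v : V) : ℝ :=
  K v u u u + K u v u u + K u u v u + K u u u v

/-- The sum of the values of a quadrilinear form over the placements of two arguments `u, u'`
among two arguments `v, v'`. -/
def mixedTwoTwo (K : V →ₗ[ℝ] V →ₗ[ℝ] V →ₗ[ℝ] V →ₗ[ℝ] ℝ) (u u' v v' : V) : ℝ :=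
  K u u' v v' + K u v u' v' + K u v v' u' + K v u u' v' + K v u v' u' + K v v' u u'

lemma quartic_combination (K : V →ₗ[ℝ] V →ₗ[ℝ] V →ₗ[ℝ] V →ₗ[ℝ] ℝ) (a b : ℝ) (u v : V) :
    K (b • u + a • v) (b • u + a • v) (b • u + a • v) (b • u + a • v) =
      b ^ 4 * K u u u u + b ^ 3 * a * mixedThreeOne K u v + b ^ 2 * a ^ 2 * mixedTwoTwo K u u v v
        + b * a ^ 3 * mixedThreeOne K v u + a ^ 4 * K v v v v := by
  simp only [mixedThreeOne, mixedTwoTwo, map_add, map_smul, LinearMap.add_apply,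
    LinearMap.smul_apply, smul_eq_mul]
  ring

variable {g : V →ₗ[ℝ] V →ₗ[ℝ] ℝ} {K : V →ₗ[ℝ] V →ₗ[ℝ] V →ₗ[ℝ] V →ₗ[ℝ] ℝ}

/-- The even and odd parts of a quartic form vanishing on the null cone. -/
lemma quartic_parts_of_null (hsymm : ∀ x y, g x y = g y x)
    (hK : ∀ x, g x x = 0 → K x x x x = 0) {u v : V} (huv : g u v = 0)
    (hu : 0 ≤ -g u u) (hu0 : g u u = 0 → u = 0) (hv : 0 ≤ g v v) (hv0 : g v v = 0 → v = 0) :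
    K u u u u * g v v ^ 2 + mixedTwoTwo K u u v v * (-g u u) * g v v
        + K v v v v * (-g u u) ^ 2 = 0 ∧
      mixedThreeOne K u v * g v v + mixedThreeOne K v u * (-g u u) = 0 := by
  -- With a² = -g(u,u) and b² = g(v,v), both bu + av and bu - av are null. Half the sum and half the
  -- difference of the two resulting equations are the even and odd parts.
  obtain ⟨a, ha, ha2⟩ : ∃ a, 0 ≤ a ∧ a ^ 2 = -g u u := ⟨_, Real.sqrt_nonneg _, Real.sq_sqrt hu⟩
  obtain ⟨b, hb, hb2⟩ : ∃ b, 0 ≤ b ∧ b ^ 2 = g v v := ⟨_, Real.sqrt_nonneg _, Real.sq_sqrt hv⟩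
  have null (c : ℝ) (hc : c ^ 2 = a ^ 2) : g (b • u + c • v) (b • u + c • v) = 0 := by
    simp only [map_add, map_smul, LinearMap.add_apply, LinearMap.smul_apply, smul_eq_mul,
      hsymm v u, huv]
    linear_combination (g u u) * hb2 + (g v v) * hc + (g v v) * ha2
  have h1 := hK _ (null a rfl)
  have h2 := hK _ (null (-a) (by ring))
  rw [quartic_combination] at h1 h2
  rw [← hb2, ← ha2]
  constructor
  · linear_combination (h1 + h2) / 2
  -- The odd part carries a factor ab. If it is zero, definiteness forces u = 0 or v = 0 and the
  -- claim is trivial; otherwise it cancels.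
  · rcases eq_or_ne a 0 with h | ha0
    · have : u = 0 := hu0 (by rw [h] at ha2; linarith)
      simp [this, h, mixedThreeOne]
    rcases eq_or_ne b 0 with h | hb0
    · have : v = 0 := hv0 (by rw [h] at hb2; linarith)
      simp [this, h, mixedThreeOne]
    have h3 : (a * b) * (mixedThreeOne K u v * b ^ 2 + mixedThreeOne K v u * a ^ 2) = 0 := by
      linear_combination (h1 - h2) / 2
    exact (mul_eq_zero.1 h3).resolve_left (mul_ne_zero ha0 hb0)

/-- A quartic form which vanishes on the null cone of an indefinite inner product is divisible by
the quadratic form of the inner product. -/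
theorem exists_bilinear_of_quartic_null {m ν : ℕ} (hν : 0 < ν) (hνm : ν < m)
    (hsymm : ∀ x y, g x y = g y x) (e : Module.Basis (Fin m) ℝ V)
    (he : ∀ i j, g (e i) (e j) = if i = j then (if (i : ℕ) < ν then -1 else 1) else 0)
    (hK : ∀ x, g x x = 0 → K x x x x = 0) :
    ∃ S : V →ₗ[ℝ] V →ₗ[ℝ] ℝ, ∀ x, K x x x x = g x x * S x x := by
  let neg := Finset.univ.filter fun i : Fin m ↦ (i : ℕ) < ν
  let pos := Finset.univ.filter fun i : Fin m ↦ ¬ (i : ℕ) < ν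
  let P : V →ₗ[ℝ] V := ∑ i ∈ neg, (e.coord i).smulRight (e i)
  let Q : V →ₗ[ℝ] V := ∑ i ∈ pos, (e.coord i).smulRight (e i)
  have hP (x : V) : P x = ∑ i ∈ neg, e.repr x i • e i := by simp [P]
  have hQ (x : V) : Q x = ∑ i ∈ pos, e.repr x i • e i := by simp [Q]
  have hPQ (x : V) : P x + Q x = x := by
    rw [hP, hQ, Finset.sum_filter_add_sum_filter_not, e.sum_repr]
  have gsum (s t : Finset (Fin m)) (c d : Fin m → ℝ) :
      g (∑ i ∈ s, c i • e i) (∑ i ∈ t, d i • e i) =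
        ∑ i ∈ s, ∑ j ∈ t, c i * d j * g (e i) (e j) := by
    simp only [map_sum, map_smul, LinearMap.sum_apply, LinearMap.smul_apply, smul_eq_mul,
      Finset.mul_sum]
    rw [Finset.sum_comm]
    exact Finset.sum_congr rfl fun i _ ↦ Finset.sum_congr rfl fun j _ ↦ by ring
  have gPQ (x y : V) : g (P x) (Q y) = 0 := by
    rw [hP, hQ, gsum]
    refine Finset.sum_eq_zero fun i hi ↦ Finset.sum_eq_zero fun j hj ↦ ?_
    have : i ≠ j := by
      rintro rfl
      exact (Finset.mem_filter.1 hj).2 (Finset.mem_filter.1 hi).2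
    simp [he, this]
  have gPP (x : V) : -g (P x) (P x) = ∑ i ∈ neg, e.repr x i ^ 2 := by
    rw [hP, gsum, ← Finset.sum_neg_distrib]
    refine Finset.sum_congr rfl fun i hi ↦ ?_
    rw [Finset.sum_eq_single i (fun j _ hj ↦ by simp [he, hj.symm]) (fun h ↦ absurd hi h), he,
      if_pos rfl, if_pos (Finset.mem_filter.1 hi).2]
    ring
  have gQQ (x : V) : g (Q x) (Q x) = ∑ i ∈ pos, e.repr x i ^ 2 := by
    rw [hQ, gsum]
    refine Finset.sum_congr rfl fun i hi ↦ ?_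
    rw [Finset.sum_eq_single i (fun j _ hj ↦ by simp [he, hj.symm]) (fun h ↦ absurd hi h), he,
      if_pos rfl, if_neg (Finset.mem_filter.1 hi).2]
    ring
  have P0 (x : V) (h : g (P x) (P x) = 0) : P x = 0 := by
    have h' := gPP x
    rw [h, neg_zero, eq_comm, Finset.sum_eq_zero_iff_of_nonneg fun i _ ↦ sq_nonneg _] at h'
    rw [hP]
    exact Finset.sum_eq_zero fun i hi ↦ by rw [pow_eq_zero_iff two_ne_zero |>.1 (h' i hi), zero_smul]
  have Q0 (x : V) (h : g (Q x) (Q x) = 0) : Q x = 0 := by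
    have h' := gQQ x
    rw [h, eq_comm, Finset.sum_eq_zero_iff_of_nonneg fun i _ ↦ sq_nonneg _] at h'
    rw [hQ]
    exact Finset.sum_eq_zero fun i hi ↦ by rw [pow_eq_zero_iff two_ne_zero |>.1 (h' i hi), zero_smul]
  have parts (x y : V) := quartic_parts_of_null hsymm hK (gPQ x y)
    (by rw [gPP]; positivity) (P0 x) (by rw [gQQ]; positivity) (Q0 y)
  have Pe (i : Fin m) (hi : (i : ℕ) < ν) : P (e i) = e i := by
    simp [hP, Finsupp.single_apply, neg, hi]
  have Qe (i : Fin m) (hi : ¬ (i : ℕ) < ν) : Q (e i) = e i := by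
    simp [hQ, Finsupp.single_apply, pos, not_lt.1 hi]
  -- Indefiniteness enters here: one reference vector of each sign is needed.
  obtain ⟨u₀, hu₀, gu₀⟩ : ∃ u₀, P u₀ = u₀ ∧ g u₀ u₀ = -1 :=
    ⟨e ⟨0, by omega⟩, Pe _ hν, by simp [he, hν]⟩
  obtain ⟨v₀, hv₀, gv₀⟩ : ∃ v₀, Q v₀ = v₀ ∧ g v₀ v₀ = 1 :=
    ⟨e ⟨ν, hνm⟩, Qe _ (lt_irrefl _), by simp [he]⟩
  -- Write x = u + v with u = Px, v = Qx. The even part against v₀ gives K(u) = g(u,u) A(u), and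
  -- against u₀ gives K(v) = -g(v,v) B(v). The odd part against each positive eⱼ gives the component
  -- cubic in u and linear in v as g(u,u) L(u,v). Then S(x,x) = A(u) - B(v) + L(u,v), with A and B
  -- polarised.
  let S : V →ₗ[ℝ] V →ₗ[ℝ] ℝ := LinearMap.mk₂ ℝ
    (fun x y ↦ mixedTwoTwo K (P x) (P y) v₀ v₀ - K v₀ v₀ v₀ v₀ * g (P x) (P y)
      - (mixedTwoTwo K u₀ u₀ (Q x) (Q y) + K u₀ u₀ u₀ u₀ * g (Q x) (Q y))
      + ∑ j ∈ pos, e.repr y j * mixedThreeOne K (e j) (P x))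
    (fun x x' y ↦ by
      simp only [mixedTwoTwo, mixedThreeOne, map_add, LinearMap.add_apply, mul_add,
        Finset.sum_add_distrib]
      ring)
    (fun c x y ↦ by
      simp only [mixedTwoTwo, mixedThreeOne, map_smul, LinearMap.smul_apply, smul_eq_mul, mul_add,
        mul_sub, Finset.sum_add_distrib, Finset.mul_sum, mul_left_comm _ c])
    (fun x y y' ↦ by
      simp only [mixedTwoTwo, map_add, LinearMap.add_apply, add_mul, mul_add, Finsupp.add_apply,
        Finset.sum_add_distrib]
      ring)
    (fun c x y ↦ by
      simp only [mixedTwoTwo, map_smul, LinearMap.smul_apply, smul_eq_mul, mul_add,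
        mul_sub, Finset.mul_sum, mul_left_comm _ c, Finsupp.smul_apply, mul_assoc])
  refine ⟨S, fun x ↦ ?_⟩
  have hS : S x x = mixedTwoTwo K (P x) (P x) v₀ v₀ - K v₀ v₀ v₀ v₀ * g (P x) (P x)
      - (mixedTwoTwo K u₀ u₀ (Q x) (Q x) + K u₀ u₀ u₀ u₀ * g (Q x) (Q x))
      + ∑ j ∈ pos, e.repr x j * mixedThreeOne K (e j) (P x) := rfl
  have hodd : mixedThreeOne K (P x) (Q x) =
      g (P x) (P x) * ∑ j ∈ pos, e.repr x j * mixedThreeOne K (e j) (P x) := by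
    have (j) (hj : j ∈ pos) : mixedThreeOne K (P x) (e j) =
        g (P x) (P x) * mixedThreeOne K (e j) (P x) := by
      have hj' := (Finset.mem_filter.1 hj).2
      have h := (parts x (e j)).2
      rw [Qe j hj', he, if_pos rfl, if_neg hj'] at h
      linear_combination h
    have hlin : mixedThreeOne K (P x) (Q x) =
        ∑ j ∈ pos, e.repr x j * mixedThreeOne K (P x) (e j) := by
      rw [hQ]
      simp only [mixedThreeOne, map_sum, map_smul, LinearMap.sum_apply, LinearMap.smul_apply,
        smul_eq_mul, mul_add, Finset.sum_add_distrib]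
    rw [hlin, Finset.mul_sum]
    exact Finset.sum_congr rfl fun j hj ↦ by rw [this j hj]; ring
  have hodd' : mixedThreeOne K (Q x) (P x) =
      g (Q x) (Q x) * ∑ j ∈ pos, e.repr x j * mixedThreeOne K (e j) (P x) := by
    rcases eq_or_ne (g (P x) (P x)) 0 with h | h
    · simp [P0 x h, mixedThreeOne]
    · have h' := (parts x x).2
      rw [hodd] at h'
      refine mul_left_cancel₀ h ?_
      linear_combination -h'
  have h40 : K (P x) (P x) (P x) (P x) = g (P x) (P x) *
      (mixedTwoTwo K (P x) (P x) v₀ v₀ - K v₀ v₀ v₀ v₀ * g (P x) (P x)) := by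
    have h := (parts x v₀).1
    rw [hv₀, gv₀] at h
    linear_combination h
  have h04 : K (Q x) (Q x) (Q x) (Q x) = -g (Q x) (Q x) *
      (mixedTwoTwo K u₀ u₀ (Q x) (Q x) + K u₀ u₀ u₀ u₀ * g (Q x) (Q x)) := by
    have h := (parts u₀ x).1
    rw [hu₀, gu₀] at h
    linear_combination h
  -- Substituting the formulas for K(u) and K(v) into the even part for the pair (u,v) leaves a
  -- common factor g(u,u) g(v,v); by definiteness it is zero only when u or v is.
  have h22 : mixedTwoTwo K (P x) (P x) (Q x) (Q x) = g (Q x) (Q x) *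
        (mixedTwoTwo K (P x) (P x) v₀ v₀ - K v₀ v₀ v₀ v₀ * g (P x) (P x)) - g (P x) (P x) *
        (mixedTwoTwo K u₀ u₀ (Q x) (Q x) + K u₀ u₀ u₀ u₀ * g (Q x) (Q x)) := by
    rcases eq_or_ne (g (P x) (P x)) 0 with h | h
    · simp [P0 x h, mixedTwoTwo]
    rcases eq_or_ne (g (Q x) (Q x)) 0 with h' | h'
    · simp [Q0 x h', mixedTwoTwo]
    have h2 := (parts x x).1
    rw [h40, h04] at h2
    refine mul_left_cancel₀ (mul_ne_zero h h') ?_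
    linear_combination -h2
  have hx := quartic_combination K 1 1 (P x) (Q x)
  have hg : g x x = g (P x) (P x) + g (Q x) (Q x) := by
    conv_lhs => rw [← hPQ x]
    simp only [map_add, LinearMap.add_apply, hsymm (Q x) (P x), gPQ]
    ring
  simp only [one_smul, hPQ, h40, h04, h22, hodd, hodd'] at hx
  rw [hx, hS, hg]
  ring

end Quartic

/-! ### Kähler tensors and their sectional curvatures -/

/-- A four-tensor with the linearity and all the symmetries of the curvature tensor of a Kähler
manifold. -/
structure IsKaehlerTensor (J : V →ₗ[ℝ] V) (T : V → V → V → V → ℝ) : Prop where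
  add_left (x x' y z u : V) : T (x + x') y z u = T x y z u + T x' y z u
  smul_left (c : ℝ) (x y z u : V) : T (c • x) y z u = c * T x y z u
  swap (x y z u : V) : T y x z u = -T x y z u
  pair_symm (x y z u : V) : T z u x y = T x y z u
  bianchi (x y z u : V) : T x y z u + T y z x u + T z x y u = 0
  invariant (x y z u : V) : T x y (J z) (J u) = T x y z u

namespace IsKaehlerTensor

variable {J : V →ₗ[ℝ] V} {T T' : V → V → V → V → ℝ}

lemma swap_right (hT : IsKaehlerTensor J T) (x y z u : V) : T x y u z = -T x y z u := by
  rw [hT.pair_symm u z x y, hT.swap z u x y, hT.pair_symm x y z u]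

lemma invariant_left (hT : IsKaehlerTensor J T) (x y z u : V) :
    T (J x) (J y) z u = T x y z u := by
  rw [← hT.pair_symm, hT.invariant, hT.pair_symm]

/-- The quadrilinear map of a Kähler tensor. -/
def toLin (hT : IsKaehlerTensor J T) : V →ₗ[ℝ] V →ₗ[ℝ] V →ₗ[ℝ] V →ₗ[ℝ] ℝ :=
  have add₂ (x y y' z u : V) : T x (y + y') z u = T x y z u + T x y' z u := by
    rw [hT.swap (y + y'), hT.add_left, hT.swap y, hT.swap y']; ring
  have smul₂ (c : ℝ) (x y z u : V) : T x (c • y) z u = c * T x y z u := by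
    rw [hT.swap (c • y), hT.smul_left, hT.swap y]; ring
  LinearMap.mk₂ ℝ
    (fun x y ↦ LinearMap.mk₂ ℝ (fun z u ↦ T x y z u)
      (fun z z' u ↦ by simp only [← hT.pair_symm x y, hT.add_left])
      (fun c z u ↦ by simp only [← hT.pair_symm x y, hT.smul_left, smul_eq_mul])
      (fun z u u' ↦ by simp only [← hT.pair_symm x y, add₂])
      (fun c z u ↦ by simp only [← hT.pair_symm x y, smul₂, smul_eq_mul]))
    (fun x x' y ↦ by ext z u; exact hT.add_left x x' y z u)
    (fun c x y ↦ by ext z u; exact hT.smul_left c x y z u)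
    (fun x y y' ↦ by ext z u; exact add₂ x y y' z u)
    (fun c x y ↦ by ext z u; exact smul₂ c x y z u)

lemma toLin_apply (hT : IsKaehlerTensor J T) (x y z u : V) : hT.toLin x y z u = T x y z u := rfl

/-- The quadrilinear map `(x, y, z, u) ↦ T(x, Jy, Jz, u)`, whose quartic form is the holomorphic
sectional curvature. -/
def holomorphic (hT : IsKaehlerTensor J T) : V →ₗ[ℝ] V →ₗ[ℝ] V →ₗ[ℝ] V →ₗ[ℝ] ℝ :=
  (hT.toLin.compl₂ J).compr₂ (LinearMap.lcomp ℝ (V →ₗ[ℝ] ℝ) J)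

lemma holomorphic_apply (hT : IsKaehlerTensor J T) (x y z u : V) :
    hT.holomorphic x y z u = T x (J y) (J z) u := rfl

protected lemma sub_smul (hT : IsKaehlerTensor J T) (hT' : IsKaehlerTensor J T') (c : ℝ) :
    IsKaehlerTensor J (fun x y z u ↦ T x y z u - c * T' x y z u) where
  add_left x x' y z u := by simp only [hT.add_left, hT'.add_left]; ring
  smul_left r x y z u := by simp only [hT.smul_left, hT'.smul_left]; ring
  swap x y z u := by simp only [hT.swap x y, hT'.swap x y]; ring
  pair_symm x y z u := by simp only [hT.pair_symm x y, hT'.pair_symm x y]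
  bianchi x y z u := by linear_combination hT.bianchi x y z u - c * hT'.bianchi x y z u
  invariant x y z u := by simp only [hT.invariant, hT'.invariant]

/-- A curvature tensor with vanishing sectional curvatures vanishes. -/
lemma eq_zero_of_sectional (hT : IsKaehlerTensor J T) (h : ∀ x y, T x y y x = 0) (x y z u : V) :
    T x y z u = 0 := by
  -- Polarisation in the outer pair, then in the inner pair, makes T invariant under cyclic
  -- permutation of its first three arguments; the Bianchi identity then reads 3T = 0.
  have h1 (x y z : V) : T x y y z = 0 := by
    have h' : hT.toLin (x + z) y y (x + z) = 0 := h (x + z) y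
    simp only [map_add, LinearMap.add_apply, toLin_apply, h] at h'
    have h2 : T z y y x = T x y y z := by
      rw [← hT.pair_symm z y y x, hT.swap x y, hT.swap_right x y y z, neg_neg]
    linarith
  have h2 (x y w z : V) : T x y w z = -T x w y z := by
    have h' : hT.toLin x (y + w) (y + w) z = 0 := h1 x (y + w) z
    simp only [map_add, LinearMap.add_apply, toLin_apply, h1] at h'
    linarith
  have h3 (x y w z : V) : T x y w z = T w x y z := by rw [h2 x y, hT.swap w x, neg_neg]
  have := hT.bianchi x y z u
  have e1 := h3 x y z u
  have e2 := h3 y z x u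
  linarith

/-- A Kähler tensor is determined by its holomorphic sectional curvatures. -/
lemma eq_zero_of_holomorphic (hT : IsKaehlerTensor J T) (hJ : ∀ x, J (J x) = -x)
    (h : ∀ x, T x (J x) (J x) x = 0) (x y z u : V) : T x y z u = 0 := by
  have neg₃ (x y z u : V) : T x y (-z) u = -T x y z u := by
    simp only [← hT.toLin_apply, map_neg, LinearMap.neg_apply]
  have neg₂ (x y z u : V) : T x (-y) z u = -T x y z u := by
    simp only [← hT.toLin_apply, map_neg, LinearMap.neg_apply]
  have hH (x : V) : hT.holomorphic x x x x = 0 := h x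
  -- The part of the holomorphic quartic form quadratic in each of x and y vanishes. It equals
  -- 4T(x,Jy,Jy,x) + 2T(x,Jx,Jy,y), and Bianchi rewrites T(x,Jx,Jy,y) as T(x,y,y,x) + T(x,Jy,Jy,x).
  have key (x y : V) : T x y y x + 3 * T x (J y) (J y) x = 0 := by
    have h1 := quartic_combination hT.holomorphic 1 1 x y
    have h2 := quartic_combination hT.holomorphic (-1) 1 x y
    simp only [hH] at h1 h2
    have h3 : mixedTwoTwo hT.holomorphic x x y y = 0 := by linear_combination -(h1 + h2) / 2
    simp only [mixedTwoTwo, holomorphic_apply] at h3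
    have e1 (x y : V) : T x (J y) (J x) y = T x (J y) (J y) x := by
      rw [← hT.invariant x (J y) (J x) y, hJ, neg₃, hT.swap_right x (J y) x (J y)]
    have e2 : T y (J x) (J x) y = T x (J y) (J y) x := by
      rw [← hT.invariant_left y, hJ, neg₂, hT.swap, neg_neg, e1]
    have e3 : T y (J y) (J x) x = T x (J x) (J y) y := by
      rw [← hT.pair_symm y (J y), hT.swap x (J x), hT.swap_right x (J x) (J y) y, neg_neg]
    have e4 := hT.bianchi x (J x) (J y) y
    rw [hT.invariant_left, hT.swap_right x y y x, hT.swap x (J y), e1] at e4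
    rw [e1 x y, e1 y x, e2, e3] at h3
    linarith
  refine hT.eq_zero_of_sectional (fun x y ↦ ?_) x y z u
  -- Replacing y by Jy exchanges the two terms; the relations a + 3b = 0 and b + 3a = 0 force a = 0.
  have h1 := key x y
  have h2 := key x (J y)
  rw [hJ, neg₂, neg₃, neg_neg] at h2
  linarith

end IsKaehlerTensor

/-! ### The tensors (φ+ψ)(S) and their Bochner tensor -/

section Bochner

variable {g S : V →ₗ[ℝ] V →ₗ[ℝ] ℝ} {J : V →ₗ[ℝ] V}

lemma form_apply_J_right (hJ : ∀ x, J (J x) = -x) (hSJ : ∀ x y, S (J x) (J y) = S x y) (x y : V) :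
    S x (J y) = -S (J x) y := by
  rw [← hSJ x (J y), hJ, map_neg]

lemma form_apply_J_swap (hJ : ∀ x, J (J x) = -x) (hS : ∀ x y, S x y = S y x)
    (hSJ : ∀ x y, S (J x) (J y) = S x y) (x y : V) : S y (J x) = -S x (J y) := by
  rw [form_apply_J_right hJ hSJ y x, hS]

/-- For a `J`-invariant symmetric form `S` the tensor `(φ + ψ)(S)` is a Kähler tensor. -/
lemma isKaehlerTensor_phi_add_psi (hJ : ∀ x, J (J x) = -x) (hg : ∀ x y, g x y = g y x)
    (hgJ : ∀ x y, g (J x) (J y) = g x y) (hS : ∀ x y, S x y = S y x)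
    (hSJ : ∀ x y, S (J x) (J y) = S x y) :
    IsKaehlerTensor J (fun x y z u ↦ phi (fun v w ↦ g v w) (fun v w ↦ S v w) x y z u
      + psi (fun v w ↦ g v w) J (fun v w ↦ S v w) x y z u) where
  add_left x x' y z u := by
    simp only [phi, psi, map_add, LinearMap.add_apply]; ring
  smul_left c x y z u := by
    simp only [phi, psi, map_smul, LinearMap.smul_apply, smul_eq_mul]; ring
  swap x y z u := by
    simp only [phi, psi, form_apply_J_swap hJ hg hgJ x y, form_apply_J_swap hJ hS hSJ x y]; ring
  pair_symm x y z u := by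
    simp only [phi, psi, hg z x, hg z y, hg u x, hg u y, hS z x, hS z y, hS u x, hS u y,
      form_apply_J_swap hJ hg hgJ x z, form_apply_J_swap hJ hS hSJ x z,
      form_apply_J_swap hJ hg hgJ x u, form_apply_J_swap hJ hS hSJ x u,
      form_apply_J_swap hJ hg hgJ y z, form_apply_J_swap hJ hS hSJ y z,
      form_apply_J_swap hJ hg hgJ y u, form_apply_J_swap hJ hS hSJ y u]
    ring
  bianchi x y z u := by
    simp only [phi, psi, hg z x, hg z y, hg y x, hS z x, hS z y, hS y x,
      form_apply_J_swap hJ hg hgJ x z, form_apply_J_swap hJ hS hSJ x z,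
      form_apply_J_swap hJ hg hgJ y z, form_apply_J_swap hJ hS hSJ y z,
      form_apply_J_swap hJ hg hgJ x y, form_apply_J_swap hJ hS hSJ x y]
    ring
  invariant x y z u := by
    simp only [phi, psi, hJ, map_neg, form_apply_J_right hJ hgJ z u, form_apply_J_right hJ hSJ z u]
    ring

/-- Of the factor 8, φ contributes 2 and ψ contributes 6. This identity is what matches S with the
quotient of the quartic form by g. -/
lemma phi_add_psi_holomorphic (hJ : ∀ x, J (J x) = -x) (hg : ∀ x y, g x y = g y x)
    (hgJ : ∀ x y, g (J x) (J y) = g x y) (hSJ : ∀ x y, S (J x) (J y) = S x y) (x : V) :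
    phi (fun v w ↦ g v w) (fun v w ↦ S v w) x (J x) (J x) x
      + psi (fun v w ↦ g v w) J (fun v w ↦ S v w) x (J x) (J x) x = 8 * (g x x * S x x) := by
  have h : g x (J x) = 0 := by linarith [form_apply_J_swap hJ hg hgJ x x]
  simp only [phi, psi, hJ, map_neg, hgJ, hSJ, hg (J x) x, h]
  ring

variable {ι : Type*} [Fintype ι] [DecidableEq ι] (e : Module.Basis ι ℝ V) {ε : ι → ℝ}

/-- The coordinates of w are g(eᵢ,w) up to the sign g(eᵢ,eᵢ), so the weighted sum reassembles F(w)
from the basis. -/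
lemma sum_contract (hε : ∀ i, ε i * ε i = 1)
    (he : ∀ i j, g (e i) (e j) = if i = j then ε i else 0) (F : V →ₗ[ℝ] ℝ) (w : V) :
    ∑ i, g (e i) (e i) * (g (e i) w * F (e i)) = F w := by
  have h (i : ι) : g (e i) w = ε i * e.repr w i := by
    conv_lhs => rw [← e.sum_repr w]
    simp only [map_sum, map_smul, smul_eq_mul, he, mul_ite, mul_zero,
      Finset.sum_ite_eq, Finset.mem_univ, if_true]
    ring
  conv_rhs => rw [← e.sum_repr w]
  simp only [map_sum, map_smul, smul_eq_mul]
  refine Finset.sum_congr rfl fun i _ ↦ ?_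
  rw [h, he, if_pos rfl]
  linear_combination e.repr w i * F (e i) * hε i

/-- The term g(x,u)S(y,z) of φ yields one copy of S for each basis vector. The two cross terms of φ
remove two copies and ψ adds six, whence the 4. -/
lemma ricci_phi_add_psi (hε : ∀ i, ε i * ε i = 1)
    (he : ∀ i j, g (e i) (e j) = if i = j then ε i else 0)
    (hJ : ∀ x, J (J x) = -x) (hg : ∀ x y, g x y = g y x)
    (hgJ : ∀ x y, g (J x) (J y) = g x y) (hS : ∀ x y, S x y = S y x)
    (hSJ : ∀ x y, S (J x) (J y) = S x y) (y z : V) :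
    ricci (fun v w ↦ g v w) e (fun x y z u ↦ phi (fun v w ↦ g v w) (fun v w ↦ S v w) x y z u
      + psi (fun v w ↦ g v w) J (fun v w ↦ S v w) x y z u) y z =
      (Fintype.card ι + 4) * S y z + trace (fun v w ↦ g v w) e (fun v w ↦ S v w) * g y z := by
  have contract (F : V →ₗ[ℝ] ℝ) (w : V) := sum_contract e hε he F w
  have summand (i : ι) : g (e i) (e i) *
      (phi (fun v w ↦ g v w) (fun v w ↦ S v w) (e i) y z (e i)
        + psi (fun v w ↦ g v w) J (fun v w ↦ S v w) (e i) y z (e i)) =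
      g y z * (g (e i) (e i) * S (e i) (e i)) - g (e i) (e i) * (g (e i) z * S y (e i))
        + S y z - g (e i) (e i) * (g (e i) y * S z (e i))
        + g (e i) (e i) * (g (e i) (J z) * S (J y) (e i))
        + 2 * (g (e i) (e i) * (g (e i) (J y) * S (J z) (e i)))
        + g (e i) (e i) * (g (e i) (J y) * S (J z) (e i))
        + 2 * (g (e i) (e i) * (g (e i) (J z) * S (J y) (e i))) := by
    have h : g (e i) (J (e i)) = 0 := by linarith [form_apply_J_swap hJ hg hgJ (e i) (e i)]
    have h' : S (e i) (J (e i)) = 0 := by linarith [form_apply_J_swap hJ hS hSJ (e i) (e i)]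
    have h1 : g (e i) (e i) * g (e i) (e i) = 1 := by rw [he, if_pos rfl, hε]
    simp only [phi, psi, h, h', form_apply_J_swap hJ hg hgJ (e i) y,
      form_apply_J_swap hJ hg hgJ (e i) z, hS (e i) (J y), hS (e i) (J z),
      form_apply_J_right hJ hSJ y (e i), form_apply_J_right hJ hSJ z (e i), hg y (e i), hS (e i) z]
    linear_combination S y z * h1
  simp only [ricci, summand, Finset.sum_add_distrib, Finset.sum_sub_distrib, ← Finset.mul_sum,
    contract, hSJ, hS z y, trace, Finset.sum_const, Finset.card_univ, nsmul_eq_mul]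
  ring

/-- The Bochner tensor of `(φ + ψ)(S)` vanishes for a `J`-invariant symmetric form `S`. -/
lemma bochner_phi_add_psi {n : ℕ} (hn : Fintype.card ι = 2 * n) (hε : ∀ i, ε i * ε i = 1)
    (he : ∀ i j, g (e i) (e j) = if i = j then ε i else 0)
    (hJ : ∀ x, J (J x) = -x) (hg : ∀ x y, g x y = g y x)
    (hgJ : ∀ x y, g (J x) (J y) = g x y) (hS : ∀ x y, S x y = S y x)
    (hSJ : ∀ x y, S (J x) (J y) = S x y) (x y z u : V) :
    bochner n (fun v w ↦ g v w) J e
      (fun x y z u ↦ phi (fun v w ↦ g v w) (fun v w ↦ S v w) x y z u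
        + psi (fun v w ↦ g v w) J (fun v w ↦ S v w) x y z u) x y z u = 0 := by
  have hT := isKaehlerTensor_phi_add_psi hJ hg hgJ hS hSJ
  set T : V → V → V → V → ℝ := fun x y z u ↦ phi (fun v w ↦ g v w) (fun v w ↦ S v w) x y z u
    + psi (fun v w ↦ g v w) J (fun v w ↦ S v w) x y z u with hTdef
  -- J-invariance gives T̄ = T and ρ* = ρ. All terms of B built from T - T̄, ρ - ρ* or τ - τ* drop
  -- out, and with them the denominators n - 1 and n - 2.
  have hconj : conj J T = T := by
    funext x y z u
    exact (hT.invariant _ _ _ _).trans (hT.invariant_left _ _ _ _)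
  have hstar (T' : V → V → V → V → ℝ) (h : ∀ x y z u, T' x y (J z) (J u) = T' x y z u) :
      ricciStar (fun v w ↦ g v w) J e T' = ricci (fun v w ↦ g v w) e T' := by
    funext y z
    simp only [ricciStar, ricci, h]
  have hric : ricci (fun v w ↦ g v w) e T = fun y z ↦
      (2 * n + 4) * S y z + trace (fun v w ↦ g v w) e (fun v w ↦ S v w) * g y z := by
    funext y z
    rw [ricci_phi_add_psi e hε he hJ hg hgJ hS hSJ, hn]
    push_cast
    rfl
  have hric2 : ricci (fun v w ↦ g v w) e (T + T) = fun y z ↦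
      2 * ((2 * n + 4) * S y z + trace (fun v w ↦ g v w) e (fun v w ↦ S v w) * g y z) := by
    funext y z
    rw [← congr_fun₂ hric y z]
    simp only [ricci, Pi.add_apply, Finset.mul_sum]
    exact Finset.sum_congr rfl fun i _ ↦ by ring
  have hric0 : ricci (fun v w ↦ g v w) e (T - T) = fun _ _ ↦ 0 := by
    funext y z
    simp [ricci]
  have htr : trace (fun v w ↦ g v w) e (ricci (fun v w ↦ g v w) e T) =
      (4 * n + 4) * trace (fun v w ↦ g v w) e (fun v w ↦ S v w) := by
    have hgg : ∑ i, g (e i) (e i) * g (e i) (e i) = 2 * n := by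
      simp only [he, if_true, hε, Finset.sum_const, Finset.card_univ, hn, nsmul_eq_mul, mul_one]
      push_cast
      rfl
    rw [hric]
    conv_lhs => rw [trace]
    simp only [mul_add, mul_left_comm (g (e _) (e _)), Finset.sum_add_distrib, ← Finset.mul_sum,
      hgg]
    rw [trace]
    ring
  simp only [bochner, hconj]
  rw [hstar T hT.invariant, hstar (T + T) (fun x y z u ↦ by simp only [Pi.add_apply, hT.invariant]),
    hstar (T - T) (fun x y z u ↦ by simp only [Pi.sub_apply, hT.invariant]), htr, hric2, hric0]
  generalize trace (fun v w ↦ g v w) e (fun v w ↦ S v w) = t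
  have h1 : (n : ℝ) + 1 ≠ 0 := by positivity
  have h2 : (n : ℝ) + 2 ≠ 0 := by positivity
  simp only [hTdef, phi, psi, pi₁, pi₂, Pi.add_apply, Pi.sub_apply, Pi.smul_apply]
  simp only [nsmul_eq_mul, sub_self, mul_zero, zero_mul, add_zero, sub_zero, zero_div]
  field_simp
  push_cast
  ring

/-- A Kähler tensor whose holomorphic sectional curvatures vanish on null vectors has vanishing
Bochner tensor. -/
theorem bochner_eq_zero_of_null {n ν : ℕ} (hν : 0 < ν) (hνn : ν < 2 * n)
    (e : Module.Basis (Fin (2 * n)) ℝ V)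
    (he : ∀ i j, g (e i) (e j) = if i = j then (if (i : ℕ) < ν then -1 else 1) else 0)
    (hJ : ∀ x, J (J x) = -x) (hg : ∀ x y, g x y = g y x) (hgJ : ∀ x y, g (J x) (J y) = g x y)
    {T : V → V → V → V → ℝ} (hT : IsKaehlerTensor J T)
    (h : ∀ x, g x x = 0 → T x (J x) (J x) x = 0) (x y z u : V) :
    bochner n (fun v w ↦ g v w) J e T x y z u = 0 := by
  obtain ⟨S₀, hS₀⟩ := exists_bilinear_of_quartic_null (K := hT.holomorphic) hν hνn hg e he h
  -- The constant is 1/4 for the average over transposition and J, times 1/8 for the factor in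
  -- `phi_add_psi_holomorphic`. The average still represents the quartic form, since that form takes
  -- the same value at x and Jx.
  let S : V →ₗ[ℝ] V →ₗ[ℝ] ℝ := (1 / 32 : ℝ) •
    (S₀ + S₀.flip + S₀.compl₁₂ J J + (S₀.compl₁₂ J J).flip)
  have hSapp (x y : V) : S x y = 1 / 32 * (S₀ x y + S₀ y x + S₀ (J x) (J y) + S₀ (J y) (J x)) := rfl
  have hS (x y : V) : S x y = S y x := by rw [hSapp, hSapp]; ring
  have hSJ (x y : V) : S (J x) (J y) = S x y := by
    rw [hSapp, hSapp]
    simp only [hJ, map_neg, LinearMap.neg_apply, neg_neg]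
    ring
  have hsec (x : V) : T x (J x) (J x) x = 8 * (g x x * S x x) := by
    have h1 : T x (J x) (J x) x = g x x * S₀ x x := hS₀ x
    have h2 : T (J x) (J (J x)) (J (J x)) (J x) = g (J x) (J x) * S₀ (J x) (J x) := hS₀ (J x)
    rw [hT.invariant_left, hT.invariant, hgJ] at h2
    rw [hSapp]
    linear_combination (h1 + h2) / 2
  have hTS : T = fun x y z u ↦ phi (fun v w ↦ g v w) (fun v w ↦ S v w) x y z u
      + psi (fun v w ↦ g v w) J (fun v w ↦ S v w) x y z u := by
    funext x y z u
    have h0 := (hT.sub_smul (isKaehlerTensor_phi_add_psi hJ hg hgJ hS hSJ) 1).eq_zero_of_holomorphic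
      hJ (fun x ↦ by rw [hsec, phi_add_psi_holomorphic hJ hg hgJ hSJ]; ring) x y z u
    linarith
  rw [hTS]
  refine bochner_phi_add_psi e (ε := fun i ↦ if (i : ℕ) < ν then -1 else 1) (by simp) ?_ he hJ hg
    hgJ hS hSJ x y z u
  intro i
  split_ifs <;> norm_num

/-- If the Bochner tensor of a tensor vanishes, then its holomorphic sectional curvatures vanish on
null vectors. -/
theorem null_of_bochner_eq_zero {ι : Type*} [Fintype ι] {n : ℕ} {e : ι → V} (hJ : ∀ x, J (J x) = -x)
    (hg : ∀ x y, g x y = g y x) (hgJ : ∀ x y, g (J x) (J y) = g x y) {T : V → V → V → V → ℝ}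
    {x : V} (hx : g x x = 0) (h : bochner n (fun v w ↦ g v w) J e T x (J x) (J x) x = 0) :
    T x (J x) (J x) x = 0 := by
  have h0 : g x (J x) = 0 := by linarith [form_apply_J_swap hJ hg hgJ x x]
  have h0' : g (J x) x = 0 := by rw [hg, h0]
  have h1 : g (J x) (J x) = 0 := by rw [hgJ, hx]
  simpa [bochner, phi, psi, pi₁, pi₂, hJ, hx, h0, h0', h1] using h

end Bochner

end Hermitian

/-! ### Smooth vector fields and the Lie bracket as a commutator -/

section Geometry

open Filter Bundle VectorField
open scoped Topology

variable {m ν : ℕ} {M : Type*} [TopologicalSpace M]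
  [ChartedSpace (EuclideanSpace ℝ (Fin m)) M] [IsManifold (𝓡 m) ∞ M]

/-- A globally smooth vector field. -/
def IsSmoothField (X : Π p : M, TangentSpace (𝓡 m) p) : Prop :=
  ContMDiff (𝓡 m) (𝓡 m).tangent ∞ (fun q ↦ (⟨q, X q⟩ : TangentBundle (𝓡 m) M))

lemma IsSmoothField.isDifferentiableField {X : Π p : M, TangentSpace (𝓡 m) p}
    (hX : IsSmoothField X) (p : M) : IsDifferentiableField X p :=
  (hX p).mdifferentiableAt (by simp)

/-- Every tangent vector extends to a globally smooth vector field that agrees with the canonical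
local extension near the base point. -/
lemma exists_isSmoothField_eventuallyEq_extend [T2Space M] (p : M) (v : TangentSpace (𝓡 m) p) :
    ∃ X : Π p : M, TangentSpace (𝓡 m) p, IsSmoothField X ∧
      ∀ᶠ q in 𝓝 p, FiberBundle.extend (EuclideanSpace ℝ (Fin m)) v q = X q := by
  obtain ⟨s, hs, hsm⟩ := FiberBundle.exists_contMDiffOn_extend (k := ∞) (𝓡 m)
    (EuclideanSpace ℝ (Fin m)) v
  obtain ⟨f, -, hf⟩ := ((SmoothBumpFunction.nhds_basis_tsupport (I := 𝓡 m) p).mem_iff.1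
    (interior_mem_nhds.2 hs))
  refine ⟨(f : M → ℝ) • FiberBundle.extend (EuclideanSpace ℝ (Fin m)) v,
    ContMDiffOn.smul_section_of_tsupport f.contMDiff.contMDiffOn isOpen_interior hf
      (hsm.mono interior_subset), ?_⟩
  filter_upwards [f.eventuallyEq_one] with q hq
  simp [hq]

lemma IsSmoothField.mlieBracket {X Y : Π p : M, TangentSpace (𝓡 m) p} (hX : IsSmoothField X)
    (hY : IsSmoothField Y) : IsSmoothField (mlieBracket (𝓡 m) X Y) := by
  have : IsManifold (𝓡 m) (((⊤ : ℕ∞) : WithTop ℕ∞) + 1) M := ‹IsManifold (𝓡 m) ∞ M›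
  have : IsManifold (𝓡 m) (minSmoothness ℝ 2) M := by
    rw [minSmoothness_of_isRCLikeNormedField]; infer_instance
  exact fun p ↦ ContMDiffAt.mlieBracket_vectorField (n := ⊤) (m := ⊤) (hX p) (hY p) (by simp)

lemma IsSmoothField.smul {f : M → ℝ} (hf : ContMDiff (𝓡 m) 𝓘(ℝ, ℝ) ∞ f)
    {X : Π p : M, TangentSpace (𝓡 m) p} (hX : IsSmoothField X) : IsSmoothField (f • X) :=
  ContMDiff.smul_section hf hX

lemma contMDiff_mvfderiv_apply {f : M → ℝ} (hf : ContMDiff (𝓡 m) 𝓘(ℝ, ℝ) ∞ f)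
    {X : Π p : M, TangentSpace (𝓡 m) p} (hX : IsSmoothField X) :
    ContMDiff (𝓡 m) 𝓘(ℝ, ℝ) ∞ (fun q ↦ mvfderiv (𝓡 m) f q (X q)) :=
  (contMDiff_snd_tangentBundle_modelSpace ℝ 𝓘(ℝ, ℝ)).comp
    ((hf.contMDiff_tangentMap (m := ∞) (by simp)).comp hX)

/-- `X Y f - Y X f = [X, Y] f` -/
lemma mvfderiv_mlieBracket_of_ne_zero {f : M → ℝ} (hf : ContMDiff (𝓡 m) 𝓘(ℝ, ℝ) ∞ f)
    {X Y Z : Π p : M, TangentSpace (𝓡 m) p} (hX : IsSmoothField X) (hY : IsSmoothField Y)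
    (hZ : IsSmoothField Z) {p : M} (hp : Z p ≠ 0) :
    mvfderiv (𝓡 m) (fun q ↦ mvfderiv (𝓡 m) f q (Y q)) p (X p)
      - mvfderiv (𝓡 m) (fun q ↦ mvfderiv (𝓡 m) f q (X q)) p (Y p)
      = mvfderiv (𝓡 m) f p (mlieBracket (𝓡 m) X Y p) := by
  have : IsManifold (𝓡 m) (minSmoothness ℝ 3) M := by
    rw [minSmoothness_of_isRCLikeNormedField]; infer_instance
  have hfd (q : M) : MDifferentiableAt (𝓡 m) 𝓘(ℝ, ℝ) f q := (hf q).mdifferentiableAt (by simp)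
  have hd {W : Π p : M, TangentSpace (𝓡 m) p} (hW : IsSmoothField W) (q : M) :
      MDifferentiableAt (𝓡 m) 𝓘(ℝ, ℝ) (fun q ↦ mvfderiv (𝓡 m) f q (W q)) q :=
    (contMDiff_mvfderiv_apply hf hW q).mdifferentiableAt (by simp)
  have bracket (W : Π p : M, TangentSpace (𝓡 m) p) :
      mlieBracket (𝓡 m) W (f • Z) =
        (fun q ↦ mvfderiv (𝓡 m) f q (W q)) • Z + f • mlieBracket (𝓡 m) W Z := by
    funext q
    exact mlieBracket_smul_right (hfd q) (hZ.isDifferentiableField q)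
  have two {U W : Π p : M, TangentSpace (𝓡 m) p} (hW : IsSmoothField W) :
      mlieBracket (𝓡 m) U (mlieBracket (𝓡 m) W (f • Z)) p =
        mvfderiv (𝓡 m) (fun q ↦ mvfderiv (𝓡 m) f q (W q)) p (U p) • Z p
        + mvfderiv (𝓡 m) f p (W p) • mlieBracket (𝓡 m) U Z p
        + (mvfderiv (𝓡 m) f p (U p) • mlieBracket (𝓡 m) W Z p
        + f p • mlieBracket (𝓡 m) U (mlieBracket (𝓡 m) W Z) p) := by
    rw [bracket, mlieBracket_add_right
      (((contMDiff_mvfderiv_apply hf hW).smul_section hZ p).mdifferentiableAt (by simp))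
      ((((hW.mlieBracket hZ).smul hf) p).mdifferentiableAt (by simp)),
      mlieBracket_smul_right (hd hW p) (hZ.isDifferentiableField p),
      mlieBracket_smul_right (hfd p) ((hW.mlieBracket hZ).isDifferentiableField p)]
  have hmin : minSmoothness ℝ 2 ≤ (∞ : WithTop ℕ∞) := by
    rw [minSmoothness_of_isRCLikeNormedField]; exact ENat.LEInfty.out
  -- The Jacobi identity for X, Y, fZ minus f times the one for X, Y, Z leaves (XYf - YXf - [X,Y]f)
  -- Z = 0 at p.
  have jac := leibniz_identity_mlieBracket_apply (I := 𝓡 m) (hX.of_le hmin p) (hY.of_le hmin p)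
    ((hZ.smul hf).of_le hmin p)
  have jac' := leibniz_identity_mlieBracket_apply (I := 𝓡 m) (hX.of_le hmin p) (hY.of_le hmin p)
    (hZ.of_le hmin p)
  rw [two hY, two hX, bracket, jac'] at jac
  have : (mvfderiv (𝓡 m) (fun q ↦ mvfderiv (𝓡 m) f q (Y q)) p (X p)
      - mvfderiv (𝓡 m) (fun q ↦ mvfderiv (𝓡 m) f q (X q)) p (Y p)
      - mvfderiv (𝓡 m) f p (mlieBracket (𝓡 m) X Y p)) • Z p = 0 := by
    simp only [Pi.add_apply, Pi.smul_apply', smul_add] at jac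
    rw [← sub_eq_zero.2 jac]
    module
  exact sub_eq_zero.1 ((smul_eq_zero.1 this).resolve_right hp)

/-- The Lie bracket of smooth vector fields is the commutator of the derivations. -/
lemma mvfderiv_mlieBracket {f : M → ℝ} (hf : ContMDiff (𝓡 m) 𝓘(ℝ, ℝ) ∞ f)
    {X Y : Π p : M, TangentSpace (𝓡 m) p} (hX : IsSmoothField X) (hY : IsSmoothField Y) (p : M) :
    mvfderiv (𝓡 m) (fun q ↦ mvfderiv (𝓡 m) f q (Y q)) p (X p)
      - mvfderiv (𝓡 m) (fun q ↦ mvfderiv (𝓡 m) f q (X q)) p (Y p)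
      = mvfderiv (𝓡 m) f p (mlieBracket (𝓡 m) X Y p) := by
  -- The auxiliary field can be X or Y itself, whichever is nonzero at p; if both vanish there, so
  -- do both sides.
  by_cases hXp : X p = 0
  · by_cases hYp : Y p = 0
    · have h : mlieBracket (𝓡 m) X Y p = 0 := by
        rw [← mlieBracketWithin_univ]
        exact mlieBracketWithin_eq_zero_of_eq_zero hXp hYp
      rw [h, hXp, hYp]
      simp only [map_zero, sub_zero]
    · exact mvfderiv_mlieBracket_of_ne_zero hf hX hY hY hYp
  · exact mvfderiv_mlieBracket_of_ne_zero hf hX hY hX hXp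

/-! ### Symmetries of the curvature on smooth vector fields -/

variable {g : IndefiniteMetric m ν M}
  {nabla : CovariantDerivative (𝓡 m) (EuclideanSpace ℝ (Fin m)) (fun p : M ↦ TangentSpace (𝓡 m) p)}
  {X Y Z W : Π p : M, TangentSpace (𝓡 m) p}

lemma IsSmoothField.inner (g : IndefiniteMetric m ν M) (hY : IsSmoothField Y)
    (hZ : IsSmoothField Z) :
    ContMDiff (𝓡 m) 𝓘(ℝ, ℝ) ∞ (fun q ↦ g.inner q (Y q) (Z q)) := by
  have h := ContMDiff.clm_bundle_apply₂ (F₁ := EuclideanSpace ℝ (Fin m))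
    (F₂ := EuclideanSpace ℝ (Fin m)) (F₃ := ℝ) (E₃ := Bundle.Trivial M ℝ) g.contMDiff hY hZ
  exact fun p ↦ (contMDiffAt_section p).1 (h p)

lemma IsSmoothField.endomorphism (H : HermitianStructure g) (hY : IsSmoothField Y) :
    IsSmoothField (fun q ↦ H.J q (Y q)) :=
  ContMDiff.clm_bundle_apply H.contMDiff hY

namespace IsLeviCivita

lemma isSmoothField (hLC : IsLeviCivita g nabla) (hY : IsSmoothField Y) (hZ : IsSmoothField Z) :
    IsSmoothField (fun q ↦ nabla Z q (Y q)) := by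
  have h := hLC.contMDiff.contMDiff.contMDiff (σ := Z) (ContMDiff.contMDiffOn hZ)
  exact ContMDiff.clm_bundle_apply (contMDiffOn_univ.1 h) hY

lemma sub_eq_mlieBracket (hLC : IsLeviCivita g nabla) (hX : IsSmoothField X)
    (hY : IsSmoothField Y) (p : M) :
    nabla Y p (X p) - nabla X p (Y p) = mlieBracket (𝓡 m) X Y p :=
  nabla.torsion_eq_zero_iff.1 hLC.torsion (hX.isDifferentiableField p) (hY.isDifferentiableField p)

/-- Covariant differentiation of vector fields only depends on their germs. -/
lemma congr_nabla (nabla : CovariantDerivative (𝓡 m) (EuclideanSpace ℝ (Fin m))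
      (fun p : M ↦ TangentSpace (𝓡 m) p)) (hY : IsSmoothField Y) {p : M}
    (h : ∀ᶠ q in 𝓝 p, Z q = Y q) : nabla Z p = nabla Y p := by
  refine nabla.isCovariantDerivativeOn.congr_of_eventuallyEq ?_ (hY.isDifferentiableField p)
    univ_mem h
  refine (hY.isDifferentiableField p).congr_of_eventuallyEq ?_
  filter_upwards [h] with q hq
  rw [hq]

/-- Connection and bracket are local, so the canonical extensions may be replaced by global smooth
fields with the same germs. Equality near p, not only at p, is needed because derivatives are
iterated. -/
lemma curvature_eq_curvatureField (hLC : IsLeviCivita g nabla) (hX : IsSmoothField X)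
    (hY : IsSmoothField Y) (hZ : IsSmoothField Z) {p : M} {x y z : TangentSpace (𝓡 m) p}
    (hx : ∀ᶠ q in 𝓝 p, FiberBundle.extend (EuclideanSpace ℝ (Fin m)) x q = X q)
    (hy : ∀ᶠ q in 𝓝 p, FiberBundle.extend (EuclideanSpace ℝ (Fin m)) y q = Y q)
    (hz : ∀ᶠ q in 𝓝 p, FiberBundle.extend (EuclideanSpace ℝ (Fin m)) z q = Z q) :
    curvature nabla p x y z = curvatureField nabla X Y Z p := by
  have hz' : ∀ᶠ q in 𝓝 p,
      nabla (FiberBundle.extend (EuclideanSpace ℝ (Fin m)) z) q = nabla Z q := by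
    filter_upwards [hz.eventually_nhds] with q hq using congr_nabla nabla hZ hq
  have h1 : ∀ᶠ q in 𝓝 p, nabla (FiberBundle.extend (EuclideanSpace ℝ (Fin m)) z) q
      (FiberBundle.extend (EuclideanSpace ℝ (Fin m)) y q) = nabla Z q (Y q) := by
    filter_upwards [hz', hy] with q h h' using by rw [h, h']
  have h2 : ∀ᶠ q in 𝓝 p, nabla (FiberBundle.extend (EuclideanSpace ℝ (Fin m)) z) q
      (FiberBundle.extend (EuclideanSpace ℝ (Fin m)) x q) = nabla Z q (X q) := by
    filter_upwards [hz', hx] with q h h' using by rw [h, h']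
  rw [curvature, curvatureField, curvatureField, congr_nabla nabla (hLC.isSmoothField hY hZ) h1,
    congr_nabla nabla (hLC.isSmoothField hX hZ) h2, hz'.self_of_nhds, hx.self_of_nhds,
    hy.self_of_nhds, EventuallyEq.mlieBracket_vectorField_eq hx hy]

/-- The commutator of X and Y as derivations is applied to the function g(Z,W). Expanding by metric
compatibility, the products of first derivatives cancel and the curvature terms remain. -/
lemma curvatureField_skew (hLC : IsLeviCivita g nabla) (hX : IsSmoothField X)
    (hY : IsSmoothField Y) (hZ : IsSmoothField Z) (hW : IsSmoothField W) (p : M) :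
    g.inner p (curvatureField nabla X Y Z p) (W p) =
      -g.inner p (Z p) (curvatureField nabla X Y W p) := by
  have first {U : Π p : M, TangentSpace (𝓡 m) p} (hU : IsSmoothField U) :
      (fun q ↦ mvfderiv (𝓡 m) (fun q ↦ g.inner q (Z q) (W q)) q (U q)) =
        (fun q ↦ g.inner q (nabla Z q (U q)) (W q)) + fun q ↦ g.inner q (Z q) (nabla W q (U q)) := by
    funext q
    exact hLC.metric (hZ.isDifferentiableField q) (hW.isDifferentiableField q) (U q)
  have second {U U' : Π p : M, TangentSpace (𝓡 m) p} (hU : IsSmoothField U) :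
      mvfderiv (𝓡 m) (fun q ↦ mvfderiv (𝓡 m) (fun q ↦ g.inner q (Z q) (W q)) q (U q)) p (U' p) =
        g.inner p (nabla (fun q ↦ nabla Z q (U q)) p (U' p)) (W p)
        + g.inner p (nabla Z p (U p)) (nabla W p (U' p))
        + (g.inner p (nabla Z p (U' p)) (nabla W p (U p))
        + g.inner p (Z p) (nabla (fun q ↦ nabla W q (U q)) p (U' p))) := by
    have hZU := hLC.isSmoothField hU hZ
    have hWU := hLC.isSmoothField hU hW
    rw [first hU, mvfderiv_add ((hZU.inner g hW p).mdifferentiableAt (by simp))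
      ((hZ.inner g hWU p).mdifferentiableAt (by simp)), add_apply,
      hLC.metric (hZU.isDifferentiableField p) (hW.isDifferentiableField p),
      hLC.metric (hZ.isDifferentiableField p) (hWU.isDifferentiableField p)]
  have key := mvfderiv_mlieBracket (hZ.inner g hW) hX hY p
  rw [second hY, second hX,
    hLC.metric (hZ.isDifferentiableField p) (hW.isDifferentiableField p)] at key
  simp only [curvatureField, map_sub, sub_apply]
  linear_combination key

lemma curvatureField_bianchi (hLC : IsLeviCivita g nabla) (hX : IsSmoothField X)
    (hY : IsSmoothField Y) (hZ : IsSmoothField Z) (p : M) :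
    curvatureField nabla X Y Z p + curvatureField nabla Y Z X p
      + curvatureField nabla Z X Y p = 0 := by
  have : IsManifold (𝓡 m) (minSmoothness ℝ 3) M := by
    rw [minSmoothness_of_isRCLikeNormedField]; infer_instance
  have hmin : minSmoothness ℝ 2 ≤ (∞ : WithTop ℕ∞) := by
    rw [minSmoothness_of_isRCLikeNormedField]; exact ENat.LEInfty.out
  have jac := leibniz_identity_mlieBracket_apply (I := 𝓡 m) (hX.of_le hmin p) (hY.of_le hmin p)
    (hZ.of_le hmin p)
  -- Using zero torsion twice, ∇_A∇_U V = ∇_A∇_V U + ∇_{[U,V]}A + [A,[U,V]]. In the cyclic sum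
  -- everything but the double brackets cancels, and these vanish by Jacobi.
  have tor {U V A : Π p : M, TangentSpace (𝓡 m) p} (hU : IsSmoothField U) (hV : IsSmoothField V)
      (hA : IsSmoothField A) :
      nabla (fun q ↦ nabla V q (U q)) p (A p) = nabla (fun q ↦ nabla U q (V q)) p (A p)
        + (nabla A p (mlieBracket (𝓡 m) U V p)
          + mlieBracket (𝓡 m) A (mlieBracket (𝓡 m) U V) p) := by
    have h : (fun q ↦ nabla V q (U q)) = (fun q ↦ nabla U q (V q)) + mlieBracket (𝓡 m) U V := by
      funext q
      rw [Pi.add_apply, ← hLC.sub_eq_mlieBracket hU hV q, add_sub_cancel]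
    have hUV := hU.mlieBracket hV
    rw [h, nabla.isCovariantDerivativeOn.add ((hLC.isSmoothField hV hU).isDifferentiableField p)
      (hUV.isDifferentiableField p) (Set.mem_univ p), add_apply,
      ← hLC.sub_eq_mlieBracket hA hUV, add_sub_cancel]
  have swap : mlieBracket (𝓡 m) (mlieBracket (𝓡 m) X Y) Z p =
    -mlieBracket (𝓡 m) Z (mlieBracket (𝓡 m) X Y) p := mlieBracket_swap_apply
  have swap' : mlieBracket (𝓡 m) Z X p = -mlieBracket (𝓡 m) X Z p := mlieBracket_swap_apply
  rw [swap] at jac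
  simp only [curvatureField]
  rw [tor hY hZ hX, tor hX hY hZ, tor hX hZ hY, swap', map_neg, jac]
  abel

lemma curvatureField_parallel {H : HermitianStructure g} (hLC : IsLeviCivita g nabla)
    (hK : IsParallel nabla H.J) (hX : IsSmoothField X) (hY : IsSmoothField Y)
    (hZ : IsSmoothField Z) (p : M) :
    curvatureField nabla X Y (fun q ↦ H.J q (Z q)) p = H.J p (curvatureField nabla X Y Z p) := by
  have h (U : Π p : M, TangentSpace (𝓡 m) p) : (fun q ↦ nabla (fun q ↦ H.J q (Z q)) q (U q)) =
      fun q ↦ H.J q (nabla Z q (U q)) := by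
    funext q
    exact hK Z q (hZ.isDifferentiableField q) (U q)
  rw [curvatureField, h, h, hK _ p ((hLC.isSmoothField hY hZ).isDifferentiableField p),
    hK _ p ((hLC.isSmoothField hX hZ).isDifferentiableField p),
    hK _ p (hZ.isDifferentiableField p), curvatureField, map_sub, map_sub]

end IsLeviCivita

/-! ### The curvature tensor at a point is a Kähler tensor -/

lemma curvatureTensor_swap (p : M) (x y z u : TangentSpace (𝓡 m) p) :
    curvatureTensor g nabla p y x z u = -curvatureTensor g nabla p x y z u := by
  have h : curvature nabla p y x z = -curvature nabla p x y z := by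
    rw [curvature, curvature, curvatureField, curvatureField, mlieBracket_swap_apply, map_neg]
    abel
  rw [curvatureTensor, curvatureTensor, h, map_neg, neg_apply]

namespace IsLeviCivita

variable [T2Space M]

lemma curvatureTensor_swap_right (hLC : IsLeviCivita g nabla) (p : M)
    (x y z u : TangentSpace (𝓡 m) p) :
    curvatureTensor g nabla p x y u z = -curvatureTensor g nabla p x y z u := by
  obtain ⟨X, hX, hx⟩ := exists_isSmoothField_eventuallyEq_extend p x
  obtain ⟨Y, hY, hy⟩ := exists_isSmoothField_eventuallyEq_extend p y
  obtain ⟨Z, hZ, hz⟩ := exists_isSmoothField_eventuallyEq_extend p z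
  obtain ⟨W, hW, hw⟩ := exists_isSmoothField_eventuallyEq_extend p u
  have hzp : z = Z p := by rw [← hz.self_of_nhds, FiberBundle.extend_apply_self]
  have hwp : u = W p := by rw [← hw.self_of_nhds, FiberBundle.extend_apply_self]
  have h := hLC.curvatureField_skew hX hY hZ hW p
  rw [curvatureTensor, curvatureTensor, hLC.curvature_eq_curvatureField hX hY hZ hx hy hz,
    hLC.curvature_eq_curvatureField hX hY hW hx hy hw, g.symm, hzp, hwp, h, neg_neg]

lemma curvatureTensor_bianchi (hLC : IsLeviCivita g nabla) (p : M)
    (x y z u : TangentSpace (𝓡 m) p) :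
    curvatureTensor g nabla p x y z u + curvatureTensor g nabla p y z x u
      + curvatureTensor g nabla p z x y u = 0 := by
  obtain ⟨X, hX, hx⟩ := exists_isSmoothField_eventuallyEq_extend p x
  obtain ⟨Y, hY, hy⟩ := exists_isSmoothField_eventuallyEq_extend p y
  obtain ⟨Z, hZ, hz⟩ := exists_isSmoothField_eventuallyEq_extend p z
  simp only [curvatureTensor]
  rw [hLC.curvature_eq_curvatureField hX hY hZ hx hy hz,
    hLC.curvature_eq_curvatureField hY hZ hX hy hz hx,
    hLC.curvature_eq_curvatureField hZ hX hY hz hx hy, ← add_apply,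
    ← add_apply, ← map_add, ← map_add, hLC.curvatureField_bianchi hX hY hZ,
    map_zero, zero_apply]

/-- The classical octahedron argument: the four Bianchi identities for the cyclic shifts of
(x,y,z,u) combine with skewness in each pair. -/
lemma curvatureTensor_pair_symm (hLC : IsLeviCivita g nabla) (p : M)
    (x y z u : TangentSpace (𝓡 m) p) :
    curvatureTensor g nabla p z u x y = curvatureTensor g nabla p x y z u := by
  have s := curvatureTensor_swap (g := g) (nabla := nabla) p
  have r := hLC.curvatureTensor_swap_right p
  have b := hLC.curvatureTensor_bianchi p
  linarith [b x y z u, b y z u x, b z u x y, b u x y z, r x y z u, r y z x u, r z x y u,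
    r z u y x, r z u x y, r u y z x, r u x y z, r x z u y, s x z u y, s x z y u, s u y z x,
    s u y x z, r y u z x, r y u x z, s y z u x, s y z x u, r u x z y, s u x z y, s u x y z]

lemma curvatureTensor_parallel {H : HermitianStructure g} (hLC : IsLeviCivita g nabla)
    (hK : IsParallel nabla H.J) (p : M) (x y z u : TangentSpace (𝓡 m) p) :
    curvatureTensor g nabla p x y (H.J p z) u = g.inner p (H.J p (curvature nabla p x y z)) u := by
  obtain ⟨X, hX, hx⟩ := exists_isSmoothField_eventuallyEq_extend p x
  obtain ⟨Y, hY, hy⟩ := exists_isSmoothField_eventuallyEq_extend p y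
  obtain ⟨Z, hZ, hz⟩ := exists_isSmoothField_eventuallyEq_extend p z
  obtain ⟨Z', hZ', hz'⟩ := exists_isSmoothField_eventuallyEq_extend p (H.J p z)
  obtain ⟨W, hW, hw⟩ := exists_isSmoothField_eventuallyEq_extend p u
  have hzp : z = Z p := by rw [← hz.self_of_nhds, FiberBundle.extend_apply_self]
  have hzp' : H.J p z = Z' p := by rw [← hz'.self_of_nhds, FiberBundle.extend_apply_self]
  have hwp : u = W p := by rw [← hw.self_of_nhds, FiberBundle.extend_apply_self]
  -- The fields Z' and JZ agree at p but possibly not near p. Skewness moves the derivatives onto W,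
  -- after which only their common value at p matters.
  rw [curvatureTensor, hLC.curvature_eq_curvatureField hX hY hZ' hx hy hz',
    hLC.curvature_eq_curvatureField hX hY hZ hx hy hz, ← hLC.curvatureField_parallel hK hX hY hZ,
    hwp, hLC.curvatureField_skew hX hY hZ' hW,
    hLC.curvatureField_skew hX hY (hZ.endomorphism H) hW, ← hzp', hzp]

lemma isKaehlerTensor (H : HermitianStructure g) (hLC : IsLeviCivita g nabla)
    (hK : IsParallel nabla H.J) (p : M) :
    Hermitian.IsKaehlerTensor (H.J p : TangentSpace (𝓡 m) p →ₗ[ℝ] TangentSpace (𝓡 m) p)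
      (curvatureTensor g nabla p) where
  add_left x x' y z u := by
    -- Linearity in x is not visible through the extension of x to a field. Pair symmetry and
    -- skewness move x to the last slot, where it enters only through g.
    simp only [← hLC.curvatureTensor_pair_symm p _ y, hLC.curvatureTensor_swap_right p z u y]
    simp only [curvatureTensor, map_add, neg_add]
  smul_left c x y z u := by
    simp only [← hLC.curvatureTensor_pair_symm p _ y, hLC.curvatureTensor_swap_right p z u y]
    simp only [curvatureTensor, map_smul, smul_eq_mul, mul_neg]
  swap x y z u := curvatureTensor_swap p x y z u
  pair_symm := hLC.curvatureTensor_pair_symm p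
  bianchi := hLC.curvatureTensor_bianchi p
  invariant x y z u := by
    rw [ContinuousLinearMap.coe_coe, hLC.curvatureTensor_parallel hK, H.isometry]
    rfl

end IsLeviCivita

/-- The inner product on a tangent space as a bilinear form. -/
def IndefiniteMetric.form (g : IndefiniteMetric m ν M) (p : M) :
    TangentSpace (𝓡 m) p →ₗ[ℝ] TangentSpace (𝓡 m) p →ₗ[ℝ] ℝ :=
  LinearMap.mk₂ ℝ (fun x y ↦ g.inner p x y) (fun x x' y ↦ by simp) (fun c x y ↦ by simp)
    (fun x y y' ↦ by simp) (fun c x y ↦ by simp)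

lemma IndefiniteMetric.basis_spec (g : IndefiniteMetric m ν M) (p : M) (i j : Fin m) :
    g.inner p (g.basis p i) (g.basis p j) =
      if i = j then (if (i : ℕ) < ν then -1 else 1) else 0 :=
  (g.exists_basis p).choose_spec i j

end Geometry

end

theorem theorem7 (n s : ℕ) (hs : 2 ≤ s) (hns : s + 2 ≤ n)
    (M : Type*) [TopologicalSpace M] [T2Space M]
    [ChartedSpace (EuclideanSpace ℝ (Fin (2 * n))) M] [IsManifold (𝓡 (2 * n)) ∞ M]
    (g : IndefiniteMetric (2 * n) (2 * s) M) (H : HermitianStructure g)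
    (nabla : CovariantDerivative (𝓡 (2 * n)) (EuclideanSpace ℝ (Fin (2 * n)))
      (fun p : M ↦ TangentSpace (𝓡 (2 * n)) p))
    (hLC : IsLeviCivita g nabla) (hK : IsParallel nabla H.J) :
    (∀ (p : M) (ξ : TangentSpace (𝓡 (2 * n)) p), g.inner p ξ ξ = 0 →
        curvatureTensor g nabla p ξ (H.J p ξ) (H.J p ξ) ξ = 0) ↔
      (∀ (p : M) (x y z u : TangentSpace (𝓡 (2 * n)) p),
        bochnerTensor g H nabla p x y z u = 0) := by
  constructor
  · intro h p x y z u
    exact Hermitian.bochner_eq_zero_of_null (g := g.form p) (by omega : 0 < 2 * s) (by omega)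
      (g.basis p) (g.basis_spec p) (H.sq p) (g.symm p) (H.isometry p) (hLC.isKaehlerTensor H hK p)
      (h p) x y z u
  · intro h p ξ hξ
    exact Hermitian.null_of_bochner_eq_zero (g := g.form p) (e := g.basis p)
      (J := (H.J p : TangentSpace (𝓡 (2 * n)) p →ₗ[ℝ] TangentSpace (𝓡 (2 * n)) p))
      (H.sq p) (g.symm p) (H.isometry p) hξ (h p ξ (H.J p ξ) (H.J p ξ) ξ)
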